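/- Let $\mathbb{K}=\mathbb{R}$ or $\mathbb{K}=\mathbb{C}$, let $\mathcal{S}(\mathbb{R})$ be the Schwartz space of rapidly decreasing smooth functions $\mathbb{R}\to\mathbb{K}$ with its usual topology, and let $\mathcal{S}'(\mathbb{R})$ be its topological dual, the space of tempered distributions. Let $c>0$ and $a>0$, and let $\varphi(x)=c\,e^{-ax^2}$. Then: (i) the family $\{x^n\varphi(x) : n\ge 0\}$ is total in $\mathcal{S}(\mathbb{R})$, that is, its linear span over $\mathbb{K}$ is dense in $\mathcal{S}(\mathbb{R})$; (ii) for this fixed kernel $\varphi$, a tempered distribution $T\in\mathcal{S}'(\mathbb{R})$ is uniquely determined by its sequence of weak moments ${}^{(\varphi)}m_n(T)=\langle T,x^n\varphi\rangle$, $n\ge 0$: if $T_1,T_2\in\mathcal{S}'(\mathbb{R})$ satisfy $\langle T_1,x^n\varphi\rangle=\langle T_2,x^n\varphi\rangle$ for all $n\ge 0$, then $T_1=T_2$. -/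

import Mathlib

open scoped SchwartzMap ContDiff

namespace WeakMoments

/-- A polynomial times `exp (-a x²)` with `a > 0` is bounded on the real line. -/
theorem exists_bound_poly_mul_gaussian {a : ℝ} (ha : 0 < a) (q : Polynomial ℝ) :
    ∃ C : ℝ, ∀ x : ℝ, |q.eval x| * Real.exp (-a * x ^ 2) ≤ C := by
  induction q using Polynomial.induction_on' with
  | add p q hp hq =>
    obtain ⟨C, hC⟩ := hp
    obtain ⟨D, hD⟩ := hq
    refine ⟨C + D, fun x => ?_⟩
    have h1 : |(p + q).eval x| ≤ |p.eval x| + |q.eval x| := by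
      rw [Polynomial.eval_add]; exact abs_add_le _ _
    have h2 := mul_le_mul_of_nonneg_right h1 (Real.exp_pos (-a * x ^ 2)).le
    linarith [hC x, hD x, add_mul |p.eval x| |q.eval x| (Real.exp (-a * x ^ 2))]
  | monomial m b =>
    refine ⟨|b| * (1 + (m.factorial : ℝ) / a ^ m), fun x => ?_⟩
    rw [Polynomial.eval_monomial, abs_mul, mul_assoc, abs_pow]
    refine mul_le_mul_of_nonneg_left ?_ (abs_nonneg b)
    have hfac : (0 : ℝ) < m.factorial := by exact_mod_cast m.factorial_pos
    have ham : 0 < a ^ m := pow_pos ha m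
    have h1 : (a * x ^ 2) ^ m / m.factorial ≤ Real.exp (a * x ^ 2) :=
      Real.pow_div_factorial_le_exp _ (by positivity) m
    have h2 : (x ^ 2) ^ m ≤ m.factorial / a ^ m * Real.exp (a * x ^ 2) := by
      rw [div_le_iff₀ hfac, mul_pow] at h1
      rw [div_mul_eq_mul_div, le_div_iff₀ ham]
      linarith
    have h3 : |x| ^ m ≤ 1 + (x ^ 2) ^ m := by
      have : (x ^ 2) ^ m = (|x| ^ m) ^ 2 := by rw [← sq_abs, ← pow_mul, ← pow_mul, mul_comm]
      rw [this]
      nlinarith [sq_nonneg (|x| ^ m - 1), sq_nonneg (|x| ^ m)]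
    have h4 : 1 ≤ Real.exp (a * x ^ 2) := Real.one_le_exp (by positivity)
    have h5 : -a * x ^ 2 = -(a * x ^ 2) := by ring
    rw [h5, Real.exp_neg, ← div_eq_mul_inv, div_le_iff₀ (Real.exp_pos _)]
    linarith [add_mul 1 ((m.factorial : ℝ) / a ^ m) (Real.exp (a * x ^ 2))]

/-- Every derivative of `c exp (-a x²)` is a polynomial times `exp (-a x²)`. -/
theorem exists_iteratedDeriv_gaussian (c a : ℝ) (n : ℕ) :
    ∃ q : Polynomial ℝ, iteratedDeriv n (fun x : ℝ => c * Real.exp (-a * x ^ 2)) =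
      fun x => q.eval x * Real.exp (-a * x ^ 2) := by
  induction n with
  | zero => exact ⟨Polynomial.C c, by simp⟩
  | succ n ih =>
    obtain ⟨q, hq⟩ := ih
    refine ⟨q.derivative - Polynomial.C (2 * a) * Polynomial.X * q, ?_⟩
    rw [iteratedDeriv_succ, hq]
    funext x
    have h1 : HasDerivAt (fun y : ℝ => Real.exp (-a * y ^ 2))
        (Real.exp (-a * x ^ 2) * (-a * (2 * x))) x := by
      have := ((hasDerivAt_pow 2 x).const_mul (-a)).exp
      simpa using this
    refine ((q.hasDerivAt x).mul h1).deriv.trans ?_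
    simp only [Polynomial.eval_sub, Polynomial.eval_mul, Polynomial.eval_C, Polynomial.eval_X]
    ring

/-- The real-valued Gaussian `x ↦ c exp (-a x²)`, `a > 0`, as a Schwartz function. -/
noncomputable def realGaussian (c a : ℝ) (ha : 0 < a) : 𝓢(ℝ, ℝ) where
  toFun x := c * Real.exp (-a * x ^ 2)
  smooth' := by fun_prop
  decay' k n := by
    obtain ⟨q, hq⟩ := exists_iteratedDeriv_gaussian c a n
    obtain ⟨C, hC⟩ := exists_bound_poly_mul_gaussian ha (Polynomial.X ^ k * q)
    refine ⟨C, fun x => le_trans (le_of_eq ?_) (hC x)⟩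
    rw [norm_iteratedFDeriv_eq_norm_iteratedDeriv, hq]
    simp only [norm_mul, Real.norm_eq_abs, Real.abs_exp, Polynomial.eval_mul,
      Polynomial.eval_pow, Polynomial.eval_X, abs_mul, abs_pow]
    ring

/-- The Gaussian kernel `φ(x) = c exp (-a x²)`, `a > 0`, as an element of the Schwartz space
of `𝕜`-valued functions (`𝕜 = ℝ` or `𝕜 = ℂ`). -/
noncomputable def gaussianKernel (𝕜 : Type*) [RCLike 𝕜] (c a : ℝ) (ha : 0 < a) : 𝓢(ℝ, 𝕜) :=
  SchwartzMap.postcompCLM (RCLike.ofRealCLM : ℝ →L[ℝ] 𝕜) (realGaussian c a ha)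

theorem gaussianKernel_apply (𝕜 : Type*) [RCLike 𝕜] (c a : ℝ) (ha : 0 < a) (x : ℝ) :
    gaussianKernel 𝕜 c a ha x = ((c * Real.exp (-a * x ^ 2) : ℝ) : 𝕜) :=
  rfl

/-- The Schwartz function `x ↦ xⁿ φ(x)`. -/
noncomputable def monomialMul {𝕜 : Type*} [RCLike 𝕜] (n : ℕ) (φ : 𝓢(ℝ, 𝕜)) : 𝓢(ℝ, 𝕜) :=
  SchwartzMap.smulLeftCLM 𝕜 (fun x : ℝ => (x : 𝕜) ^ n) φ

theorem monomialMul_apply {𝕜 : Type*} [RCLike 𝕜] (n : ℕ) (φ : 𝓢(ℝ, 𝕜)) (x : ℝ) :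
    monomialMul n φ x = (x : 𝕜) ^ n * φ x := by
  have h : (fun x : ℝ => (x : 𝕜) ^ n).HasTemperateGrowth :=
    Function.HasTemperateGrowth.pow (by fun_prop) n
  rw [monomialMul, SchwartzMap.smulLeftCLM_apply_apply h, smul_eq_mul]

/-- The `n`-th weak moment `⟨T, xⁿ φ⟩` of the distribution-kernel pair `(T, φ)`.
For `𝕜 = ℂ` the type of `T` is Mathlib's space `𝓢'(ℝ, ℂ)` of tempered distributions. -/
noncomputable def weakMoment {𝕜 : Type*} [RCLike 𝕜]
    (T : 𝓢(ℝ, 𝕜) →Lₚₜ[𝕜] 𝕜) (φ : 𝓢(ℝ, 𝕜)) (n : ℕ) : 𝕜 :=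
  T (monomialMul n φ)

/-- A family is total in a topological vector space if its linear span is dense. -/
def IsTotal (𝕜 : Type*) {ι V : Type*} [Semiring 𝕜] [AddCommMonoid V] [Module 𝕜 V]
    [TopologicalSpace V] (f : ι → V) : Prop :=
  Dense (Submodule.span 𝕜 (Set.range f) : Set V)

end WeakMoments

open MeasureTheory Filter Topology SchwartzMap

namespace WeakMoments

/-! Schwartz functions vanish at infinity, so lower derivatives are recovered from higher ones by
integration. Hence any finite set of Schwartz seminorms is dominated by one Hilbert norm `‖(1 +
x²)^(3N) g^(N)‖₂` with `N` large (`exists_seminorm_le_weightedL2`), and it suffices to approximate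
in these norms.

Without derivatives this is the classical moment argument: if `h ∈ L²` is orthogonal to all `(1 +
x²)ᴷ xⁿ φ`, then `(1 + x²)ᴷ φ h` has exponential moments and zero moments, so its Fourier transform
vanishes and `h = 0` (`dense_weightedL2_gaussianSpan`).

Derivatives are added by induction: approximate `f'` by `p` in the span and integrate. Since `(xⁿφ)'
= n xⁿ⁻¹φ - 2a xⁿ⁺¹φ`, one has `p = q' + bφ` with `q` in the span, and `b` is small because `f' -
q'` has integral zero. -/

/-! ### Weighted `L²` norms -/

theorem hasTemperateGrowth_one_add_sq_pow (K : ℕ) :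
    (fun x : ℝ => (1 + x ^ 2) ^ K).HasTemperateGrowth := by
  have h : (fun x : ℝ => 1 + x ^ 2).HasTemperateGrowth :=
    (Function.HasTemperateGrowth.const 1).add (Function.HasTemperateGrowth.id'.pow 2)
  exact h.pow K

/-- The map sending a Schwartz function `g` to the `L²` class of `(1 + x²)ᴷ g`. -/
noncomputable def weightedL2 (K : ℕ) : 𝓢(ℝ, ℝ) →L[ℝ] Lp ℝ 2 (volume : Measure ℝ) :=
  (SchwartzMap.toLpCLM ℝ ℝ 2).comp (SchwartzMap.smulLeftCLM ℝ fun x : ℝ => (1 + x ^ 2) ^ K)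

theorem coeFn_weightedL2 (K : ℕ) (g : 𝓢(ℝ, ℝ)) :
    weightedL2 K g =ᵐ[volume] fun x => (1 + x ^ 2) ^ K * g x := by
  refine (SchwartzMap.coeFn_toLp _ 2 volume).trans (.of_forall fun x => ?_)
  exact SchwartzMap.smulLeftCLM_apply_apply (hasTemperateGrowth_one_add_sq_pow K) g x

theorem norm_weightedL2_mono {K L : ℕ} (h : K ≤ L) (g : 𝓢(ℝ, ℝ)) :
    ‖weightedL2 K g‖ ≤ ‖weightedL2 L g‖ := by
  refine Lp.norm_le_norm_of_ae_le ?_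
  filter_upwards [coeFn_weightedL2 K g, coeFn_weightedL2 L g] with x h1 h2
  rw [h1, h2, norm_mul, norm_mul]
  gcongr
  rw [Real.norm_of_nonneg (by positivity), Real.norm_of_nonneg (by positivity)]
  exact pow_le_pow_right₀ (by nlinarith) h

theorem memLp_inv_one_add_sq : MemLp (fun x : ℝ => (1 + x ^ 2)⁻¹) 2 volume := by
  rw [memLp_two_iff_integrable_sq
    (Continuous.aestronglyMeasurable (by fun_prop (disch := intros; positivity)))]
  refine integrable_inv_one_add_sq.mono'
    (Continuous.aestronglyMeasurable (by fun_prop (disch := intros; positivity)))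
    (.of_forall fun x => ?_)
  rw [Real.norm_of_nonneg (by positivity)]
  exact pow_le_of_le_one (by positivity) (inv_le_one_of_one_le₀ (by nlinarith)) two_ne_zero

theorem integrable_one_add_sq_pow_mul_abs (K : ℕ) (g : 𝓢(ℝ, ℝ)) :
    Integrable fun x => (1 + x ^ 2) ^ K * |g x| := by
  refine (SchwartzMap.smulLeftCLM ℝ (fun x : ℝ => (1 + x ^ 2) ^ K) g).integrable.norm.congr
    (.of_forall fun x => ?_)
  simp only [SchwartzMap.smulLeftCLM_apply_apply (hasTemperateGrowth_one_add_sq_pow K),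
    smul_eq_mul, norm_mul, Real.norm_eq_abs]
  rw [abs_of_nonneg (by positivity : (0 : ℝ) ≤ (1 + x ^ 2) ^ K)]

/-- The `L²` norm of `x ↦ 1 / (1 + x²)`. -/
noncomputable def normInvOneAddSq : ℝ := ‖memLp_inv_one_add_sq.toLp‖

theorem normInvOneAddSq_nonneg : 0 ≤ normInvOneAddSq := norm_nonneg _

/-- Cauchy–Schwarz against `1 / (1 + x²)`, at the cost of one power of the weight. -/
theorem integral_one_add_sq_pow_mul_abs_le (K : ℕ) (g : 𝓢(ℝ, ℝ)) :
    ∫ x, (1 + x ^ 2) ^ K * |g x| ≤ normInvOneAddSq * ‖weightedL2 (K + 1) g‖ := by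
  have h := real_inner_le_norm memLp_inv_one_add_sq.toLp |weightedL2 (K + 1) g|
  rw [norm_abs_eq_norm] at h
  refine le_trans (le_of_eq ?_) h
  rw [L2.inner_def]
  refine integral_congr_ae ?_
  filter_upwards [memLp_inv_one_add_sq.coeFn_toLp, Lp.coeFn_abs (weightedL2 (K + 1) g),
    coeFn_weightedL2 (K + 1) g] with x h1 h2 h3
  have hp : (0 : ℝ) < 1 + x ^ 2 := by positivity
  rw [h1, h2, h3]
  simp only [RCLike.inner_apply, conj_trivial, abs_mul, abs_pow, abs_of_pos hp]
  field_simp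
  ring

/-! ### Schwartz seminorms controlled by one weighted `L²` norm -/

/-- Up to sign, `g x` is the integral of `g'` over the half-line from `x` away from the origin,
where `x² ≤ t²` lets the weight move under the integral. -/
theorem one_add_sq_pow_mul_abs_le_integral (K : ℕ) (g : 𝓢(ℝ, ℝ)) (x : ℝ) :
    (1 + x ^ 2) ^ K * |g x| ≤ ∫ t, (1 + t ^ 2) ^ K * |SchwartzMap.derivCLM ℝ ℝ g t| := by
  set g' := SchwartzMap.derivCLM ℝ ℝ g
  have hd : ∀ t, HasDerivAt g (g' t) t := fun t => g.hasDerivAt t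
  have hi := integrable_one_add_sq_pow_mul_abs K g'
  have key : ∀ s : Set ℝ, MeasurableSet s → (∀ t ∈ s, x ^ 2 ≤ t ^ 2) →
      |g x| = |∫ t in s, g' t| →
      (1 + x ^ 2) ^ K * |g x| ≤ ∫ t, (1 + t ^ 2) ^ K * |g' t| := by
    intro s hs hxs h
    calc (1 + x ^ 2) ^ K * |g x| ≤ (1 + x ^ 2) ^ K * ∫ t in s, |g' t| := by
          rw [h]; gcongr; exact abs_integral_le_integral_abs
      _ = ∫ t in s, (1 + x ^ 2) ^ K * |g' t| := (integral_const_mul _ _).symm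
      _ ≤ ∫ t in s, (1 + t ^ 2) ^ K * |g' t| := by
          refine setIntegral_mono_on (g'.integrable.abs.const_mul _).integrableOn
            hi.integrableOn hs fun t ht => ?_
          have := hxs t ht
          gcongr
      _ ≤ _ := setIntegral_le_integral hi (.of_forall fun t => by positivity)
  have hc := g.tendsto_cocompact
  rcases le_total 0 x with hx | hx
  · refine key (Set.Ioi x) measurableSet_Ioi (fun t ht => ?_) ?_
    · have : x < t := ht
      nlinarith
    · rw [integral_Ioi_of_hasDerivAt_of_tendsto' (fun t _ => hd t) g'.integrable.integrableOn
        (hc.mono_left atTop_le_cocompact)]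
      simp
  · refine key (Set.Iic x) measurableSet_Iic (fun t ht => ?_) ?_
    · have : t ≤ x := ht
      nlinarith
    · rw [integral_Iic_of_hasDerivAt_of_tendsto' (fun t _ => hd t) g'.integrable.integrableOn
        (hc.mono_left atBot_le_cocompact)]
      simp

theorem one_add_sq_pow_mul_abs_le (K : ℕ) (g : 𝓢(ℝ, ℝ)) (x : ℝ) :
    (1 + x ^ 2) ^ K * |g x| ≤
      normInvOneAddSq * ‖weightedL2 (K + 1) (SchwartzMap.derivCLM ℝ ℝ g)‖ :=
  (one_add_sq_pow_mul_abs_le_integral K g x).trans (integral_one_add_sq_pow_mul_abs_le K _)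

/-- The pointwise bound at weight `K + 1` leaves a spare factor `1 / (1 + x²)`, which is square
integrable. -/
theorem norm_weightedL2_le_deriv (K : ℕ) (g : 𝓢(ℝ, ℝ)) :
    ‖weightedL2 K g‖ ≤
      normInvOneAddSq ^ 2 * ‖weightedL2 (K + 2) (SchwartzMap.derivCLM ℝ ℝ g)‖ := by
  rw [pow_two, mul_assoc, mul_comm]
  refine Lp.norm_le_mul_norm_of_ae_le_mul (g := memLp_inv_one_add_sq.toLp) ?_
  filter_upwards [coeFn_weightedL2 K g, memLp_inv_one_add_sq.coeFn_toLp] with x h1 h2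
  have hp : (0 : ℝ) < 1 + x ^ 2 := by positivity
  have h := one_add_sq_pow_mul_abs_le (K + 1) g x
  rw [h1, h2, norm_mul, norm_inv, norm_pow, Real.norm_of_nonneg hp.le, Real.norm_eq_abs,
    ← div_eq_mul_inv, le_div_iff₀ hp]
  calc _ = (1 + x ^ 2) ^ (K + 1) * |g x| := by ring
    _ ≤ _ := h

theorem norm_weightedL2_le_iterate_deriv (K n d : ℕ) (g : 𝓢(ℝ, ℝ)) :
    ‖weightedL2 K ((SchwartzMap.derivCLM ℝ ℝ ^ n) g)‖ ≤
      (normInvOneAddSq ^ 2) ^ d *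
        ‖weightedL2 (K + 2 * d) ((SchwartzMap.derivCLM ℝ ℝ ^ (n + d)) g)‖ := by
  induction d with
  | zero => simp
  | succ d ih =>
    refine ih.trans ?_
    rw [pow_succ (normInvOneAddSq ^ 2), mul_assoc]
    gcongr
    have := norm_weightedL2_le_deriv (K + 2 * d) ((SchwartzMap.derivCLM ℝ ℝ ^ (n + d)) g)
    rwa [← mul_apply_eq_comp, ← pow_succ'] at this

theorem coe_derivCLM_pow (n : ℕ) (g : 𝓢(ℝ, ℝ)) :
    ((SchwartzMap.derivCLM ℝ ℝ ^ n) g : ℝ → ℝ) = iteratedDeriv n g := by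
  induction n with
  | zero => simp
  | succ n ih =>
    rw [pow_succ', mul_apply_eq_comp, iteratedDeriv_succ, ← ih]
    rfl

/-- The sup bound spends one derivative, hence `n < N`. Each of the remaining `d = N - n - 1`
derivatives costs two powers of the weight, and `k + 1 + 2d ≤ 3N`. -/
theorem exists_seminorm_le_weightedL2 {k n N : ℕ} (hk : k ≤ N) (hn : n < N) :
    ∃ C : ℝ, 0 ≤ C ∧ ∀ g : 𝓢(ℝ, ℝ), SchwartzMap.seminorm ℝ k n g ≤
      C * ‖weightedL2 (3 * N) ((SchwartzMap.derivCLM ℝ ℝ ^ N) g)‖ := by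
  have h0 := normInvOneAddSq_nonneg
  obtain ⟨d, rfl⟩ := Nat.exists_eq_add_of_lt hn
  refine ⟨normInvOneAddSq * (normInvOneAddSq ^ 2) ^ d, by positivity, fun g => ?_⟩
  refine SchwartzMap.seminorm_le_bound' ℝ k n g (by positivity) fun x => ?_
  have h1 := one_add_sq_pow_mul_abs_le k ((SchwartzMap.derivCLM ℝ ℝ ^ n) g) x
  rw [← mul_apply_eq_comp, ← pow_succ', coe_derivCLM_pow] at h1
  have h2 := norm_weightedL2_le_iterate_deriv (k + 1) (n + 1) d g
  have h3 := norm_weightedL2_mono (show k + 1 + 2 * d ≤ 3 * (n + d + 1) by omega)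
    ((SchwartzMap.derivCLM ℝ ℝ ^ (n + d + 1)) g)
  have hx : |x| ^ k ≤ (1 + x ^ 2) ^ k :=
    pow_le_pow_left₀ (abs_nonneg x) (by nlinarith [sq_abs x, sq_nonneg (|x| - 1)]) k
  rw [show n + 1 + d = n + d + 1 by ring] at h2
  calc |x| ^ k * ‖iteratedDeriv n g x‖ ≤ (1 + x ^ 2) ^ k * |iteratedDeriv n g x| := by
        rw [Real.norm_eq_abs]; gcongr
    _ ≤ _ := h1
    _ ≤ normInvOneAddSq * ((normInvOneAddSq ^ 2) ^ d *
        ‖weightedL2 (3 * (n + d + 1)) ((SchwartzMap.derivCLM ℝ ℝ ^ (n + d + 1)) g)‖) := by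
        gcongr; exact h2.trans (by gcongr)
    _ = _ := by ring

/-- Serves to bound the coefficient `b` of the Gaussian in the induction on derivatives. -/
theorem exists_abs_integral_le_weightedL2 (n : ℕ) :
    ∃ C : ℝ, 0 ≤ C ∧ ∀ g : 𝓢(ℝ, ℝ), |∫ x, g x| ≤
      C * ‖weightedL2 (1 + 2 * n) ((SchwartzMap.derivCLM ℝ ℝ ^ n) g)‖ := by
  have h0 := normInvOneAddSq_nonneg
  refine ⟨normInvOneAddSq * (normInvOneAddSq ^ 2) ^ n, by positivity, fun g => ?_⟩
  have h1 := integral_one_add_sq_pow_mul_abs_le 0 g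
  have h2 := norm_weightedL2_le_iterate_deriv 1 0 n g
  simp only [pow_zero, one_mul, zero_add, one_apply_eq_self] at h1 h2
  calc |∫ x, g x| ≤ ∫ x, |g x| := abs_integral_le_integral_abs
    _ ≤ _ := h1
    _ ≤ _ := by rw [mul_assoc]; gcongr

/-! ### Vanishing moments and the Fourier transform -/

open FourierTransform in
/-- An integrable function with vanishing Fourier transform vanishes almost everywhere. -/
theorem ae_eq_zero_of_integral_exp_eq_zero {u : ℝ → ℝ} (hu : Integrable u)
    (h : ∀ t : ℝ, ∫ x : ℝ, Complex.exp (t * x * Complex.I) * (u x : ℂ) = 0) :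
    u =ᵐ[volume] 0 := by
  have hF : ∀ t : ℝ, 𝓕 (fun x => (u x : ℂ)) t = 0 := fun t => by
    rw [Real.fourier_real_eq_integral_exp_smul, ← h (-2 * Real.pi * t)]
    refine integral_congr_ae (.of_forall fun x => ?_)
    simp only [smul_eq_mul]
    push_cast
    ring_nf
  -- Each test function is the Fourier transform of a Schwartz function `H`; the transform is then
  -- moved from `H` onto `u`.
  refine ae_eq_zero_of_integral_contDiff_smul_eq_zero hu.locallyIntegrable fun g hg hgs => ?_
  have hgs' : HasCompactSupport fun x => (g x : ℂ) := hgs.comp_left Complex.ofReal_zero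
  set G : 𝓢(ℝ, ℂ) := hgs'.toSchwartzMap (Complex.ofRealCLM.contDiff.comp hg)
  set H : 𝓢(ℝ, ℂ) := 𝓕⁻ G
  have hG : ∀ x, 𝓕 (H : ℝ → ℂ) x = g x := fun x => by
    rw [← SchwartzMap.fourier_coe, FourierTransform.fourier_fourierInv_eq]
    rfl
  have key : ∫ t, 𝓕 (fun x => (u x : ℂ)) t • H t = ∫ x, (u x : ℂ) • 𝓕 (H : ℝ → ℂ) x := by
    simpa using! VectorFourier.integral_fourierIntegral_smul_eq_flip (L := innerₗ ℝ)
      Real.continuous_fourierChar continuous_inner (hu.ofReal (𝕜 := ℂ)) H.integrable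
  simp only [hF, hG, zero_mul, integral_zero, smul_eq_mul, ← Complex.ofReal_mul] at key
  rw [integral_complex_ofReal] at key
  simp only [smul_eq_mul, mul_comm (g _)]
  exact_mod_cast key.symm

/-- A function with exponential moments all of whose moments vanish has vanishing Fourier
transform. -/
theorem integral_exp_eq_zero_of_moments_eq_zero {u : ℝ → ℝ} (hm : AEStronglyMeasurable u)
    (hu : ∀ t : ℝ, Integrable fun x => Real.exp (|t| * |x|) * |u x|)
    (h : ∀ n : ℕ, ∫ x, x ^ n * u x = 0) (t : ℝ) :
    ∫ x : ℝ, Complex.exp (t * x * Complex.I) * (u x : ℂ) = 0 := by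
  have hexp : ∀ x : ℝ, HasSum (fun n : ℕ => (|t| * |x|) ^ n / n.factorial * |u x|)
      (Real.exp (|t| * |x|) * |u x|) := fun x => by
    refine HasSum.mul_right _ ?_
    rw [Real.exp_eq_exp_ℝ]
    exact NormedSpace.expSeries_div_hasSum_exp _
  -- Termwise integration of the exponential series, dominated by `exp (|t| |x|) |u x|`; each term
  -- is a multiple of a moment.
  have hs := hasSum_integral_of_dominated_convergence (μ := (volume : Measure ℝ))
    (F := fun (n : ℕ) (x : ℝ) => (t * x * Complex.I) ^ n / n.factorial * (u x : ℂ))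
    (f := fun x : ℝ => Complex.exp (t * x * Complex.I) * (u x : ℂ))
    (fun n x => (|t| * |x|) ^ n / n.factorial * |u x|) ?_ ?_ ?_ ?_ ?_
  · refine hs.unique ?_
    convert hasSum_zero with n
    have : ∀ x : ℝ, (t * x * Complex.I) ^ n / n.factorial * (u x : ℂ) =
        (t * Complex.I) ^ n / n.factorial * ((x ^ n * u x : ℝ) : ℂ) := fun x => by
      push_cast; ring
    simp_rw [this]
    rw [integral_const_mul, integral_complex_ofReal, h n]
    simp
  · exact fun n => (Continuous.aestronglyMeasurable (by fun_prop)).mul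
      (Complex.continuous_ofReal.comp_aestronglyMeasurable hm)
  · refine fun n => .of_forall fun x => le_of_eq ?_
    simp
  · exact .of_forall fun x => (hexp x).summable
  · refine (hu t).congr (.of_forall fun x => ?_)
    exact (hexp x).tsum_eq.symm
  · refine .of_forall fun x => HasSum.mul_right _ ?_
    rw [Complex.exp_eq_exp_ℂ]
    exact NormedSpace.expSeries_div_hasSum_exp _

/-! ### Density in weighted `L²` -/

/-- The real span of the functions `xⁿ c exp (-a x²)`. -/
noncomputable def gaussianSpan (c a : ℝ) (ha : 0 < a) : Submodule ℝ 𝓢(ℝ, ℝ) :=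
  Submodule.span ℝ (Set.range fun n : ℕ => monomialMul n (gaussianKernel ℝ c a ha))

theorem monomialMul_gaussianKernel_apply (c a : ℝ) (ha : 0 < a) (n : ℕ) (x : ℝ) :
    monomialMul n (gaussianKernel ℝ c a ha) x = x ^ n * (c * Real.exp (-a * x ^ 2)) := by
  rw [monomialMul_apply, gaussianKernel_apply]
  simp

/-- Completing the square, `|t| |x| ≤ t² / (2a) + (a / 2) x²`, so half of the Gaussian decay
survives. -/
theorem memLp_exp_mul_gaussian (K : ℕ) (c a t : ℝ) (ha : 0 < a) :
    MemLp (fun x : ℝ => Real.exp (|t| * |x|) * ((1 + x ^ 2) ^ K * (c * Real.exp (-a * x ^ 2)))) 2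
      volume := by
  have h := (SchwartzMap.smulLeftCLM ℝ (fun x : ℝ => (1 + x ^ 2) ^ K)
    (realGaussian (c * Real.exp (t ^ 2 / (2 * a))) (a / 2) (half_pos ha))).memLp 2 volume
  refine h.mono (Continuous.aestronglyMeasurable (by fun_prop)) (.of_forall fun x => ?_)
  rw [SchwartzMap.smulLeftCLM_apply_apply (hasTemperateGrowth_one_add_sq_pow K), smul_eq_mul]
  change _ ≤ ‖(1 + x ^ 2) ^ K * (c * Real.exp (t ^ 2 / (2 * a)) * Real.exp (-(a / 2) * x ^ 2))‖
  simp only [norm_mul, Real.norm_eq_abs, Real.abs_exp]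
  have hle : |t| * |x| + -a * x ^ 2 ≤ t ^ 2 / (2 * a) + -(a / 2) * x ^ 2 := by
    have h2 : t ^ 2 / (2 * a) + -(a / 2) * x ^ 2 - (|t| * |x| + -a * x ^ 2) =
        (|t| - a * |x|) ^ 2 / (2 * a) := by
      rw [← sq_abs t, ← sq_abs x]; field_simp; ring
    have h3 : 0 ≤ (|t| - a * |x|) ^ 2 / (2 * a) := by positivity
    linarith
  have h4 := Real.exp_le_exp.mpr hle
  rw [Real.exp_add, Real.exp_add] at h4
  calc _ = |(1 + x ^ 2) ^ K| * |c| * (Real.exp (|t| * |x|) * Real.exp (-a * x ^ 2)) := by ring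
    _ ≤ |(1 + x ^ 2) ^ K| * |c| *
        (Real.exp (t ^ 2 / (2 * a)) * Real.exp (-(a / 2) * x ^ 2)) := by gcongr
    _ = _ := by ring

theorem dense_weightedL2_gaussianSpan (K : ℕ) {c a : ℝ} (hc : 0 < c) (ha : 0 < a) :
    ((gaussianSpan c a ha).map (weightedL2 K).toLinearMap).topologicalClosure = ⊤ := by
  rw [Submodule.topologicalClosure_eq_top_iff, Submodule.eq_bot_iff]
  intro h hh
  set u : ℝ → ℝ := fun x => (1 + x ^ 2) ^ K * (c * Real.exp (-a * x ^ 2)) * h x with hu_def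
  have hmom : ∀ n : ℕ, ∫ x, x ^ n * u x = 0 := fun n => by
    have h1 := Submodule.inner_right_of_mem_orthogonal (Submodule.mem_map_of_mem
      (f := (weightedL2 K).toLinearMap) (Submodule.subset_span (Set.mem_range_self n) :
        monomialMul n (gaussianKernel ℝ c a ha) ∈ gaussianSpan c a ha)) hh
    rw [L2.inner_def] at h1
    rw [← h1]
    refine integral_congr_ae ?_
    filter_upwards [coeFn_weightedL2 K (monomialMul n (gaussianKernel ℝ c a ha))] with x hx
    change _ = inner ℝ (weightedL2 K (monomialMul n (gaussianKernel ℝ c a ha)) x) (h x)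
    rw [hx, monomialMul_gaussianKernel_apply]
    simp only [RCLike.inner_apply, conj_trivial, hu_def]
    ring
  have hint : ∀ t : ℝ, Integrable fun x => Real.exp (|t| * |x|) * |u x| := fun t => by
    refine ((memLp_exp_mul_gaussian K c a t ha).integrable_mul (Lp.memLp h)).norm.congr
      (.of_forall fun x => ?_)
    simp only [hu_def, Pi.mul_apply, Real.norm_eq_abs, abs_mul, Real.abs_exp]
    ring
  have hmeas : AEStronglyMeasurable u :=
    (Continuous.aestronglyMeasurable (by fun_prop)).mul (Lp.aestronglyMeasurable h)
  have hu : Integrable u := by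
    refine (integrable_norm_iff hmeas).mp ((hint 0).congr (.of_forall fun x => ?_))
    simp
  have hz := ae_eq_zero_of_integral_exp_eq_zero hu
    (integral_exp_eq_zero_of_moments_eq_zero hmeas hint hmom)
  refine (Lp.eq_zero_iff_ae_eq_zero).mpr ?_
  filter_upwards [hz] with x hx
  have hp : (1 + x ^ 2) ^ K * (c * Real.exp (-a * x ^ 2)) ≠ 0 := by positivity
  exact (mul_eq_zero.mp hx).resolve_left hp

theorem exists_gaussianSpan_weightedL2_sub_lt (K : ℕ) {c a : ℝ} (hc : 0 < c) (ha : 0 < a)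
    (f : 𝓢(ℝ, ℝ)) {ε : ℝ} (hε : 0 < ε) :
    ∃ q ∈ gaussianSpan c a ha, ‖weightedL2 K (f - q)‖ < ε := by
  have h : weightedL2 K f ∈
      ((gaussianSpan c a ha).map (weightedL2 K).toLinearMap).topologicalClosure := by
    rw [dense_weightedL2_gaussianSpan K hc ha]; trivial
  obtain ⟨_, ⟨q, hq, rfl⟩, hlt⟩ := Metric.mem_closure_iff.mp h ε hε
  refine ⟨q, hq, ?_⟩
  rwa [dist_eq_norm, ← ContinuousLinearMap.coe_coe, ← map_sub] at hlt

/-! ### Approximation of derivatives -/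

theorem hasDerivAt_monomialMul_gaussianKernel (c a : ℝ) (ha : 0 < a) (n : ℕ) (x : ℝ) :
    HasDerivAt (monomialMul n (gaussianKernel ℝ c a ha))
      (n * (x ^ (n - 1) * (c * Real.exp (-a * x ^ 2))) -
        2 * a * (x ^ (n + 1) * (c * Real.exp (-a * x ^ 2)))) x := by
  have h1 : HasDerivAt (fun y : ℝ => Real.exp (-a * y ^ 2))
      (Real.exp (-a * x ^ 2) * (-a * (2 * x))) x := by
    simpa using ((hasDerivAt_pow 2 x).const_mul (-a)).exp
  have h2 := (hasDerivAt_pow n x).mul (h1.const_mul c)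
  rw [show ⇑(monomialMul n (gaussianKernel ℝ c a ha)) =
    (fun y => y ^ n * (c * Real.exp (-a * y ^ 2))) from
      funext (monomialMul_gaussianKernel_apply c a ha n)]
  refine h2.congr_deriv ?_
  ring

theorem derivCLM_monomialMul_gaussianKernel (c a : ℝ) (ha : 0 < a) (n : ℕ) :
    SchwartzMap.derivCLM ℝ ℝ (monomialMul n (gaussianKernel ℝ c a ha)) =
      (n : ℝ) • monomialMul (n - 1) (gaussianKernel ℝ c a ha) -
        (2 * a) • monomialMul (n + 1) (gaussianKernel ℝ c a ha) := by
  ext x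
  rw [SchwartzMap.derivCLM_apply, (hasDerivAt_monomialMul_gaussianKernel c a ha n x).deriv,
    sub_apply, smul_apply, smul_apply,
    monomialMul_gaussianKernel_apply, monomialMul_gaussianKernel_apply, smul_eq_mul, smul_eq_mul]

/-- Up to a multiple of the Gaussian, elements of `gaussianSpan` have a primitive there. -/
theorem exists_eq_deriv_add_smul {c a : ℝ} (ha : 0 < a) {p : 𝓢(ℝ, ℝ)}
    (hp : p ∈ gaussianSpan c a ha) :
    ∃ q ∈ gaussianSpan c a ha, ∃ b : ℝ,
      p = SchwartzMap.derivCLM ℝ ℝ q + b • monomialMul 0 (gaussianKernel ℝ c a ha) := by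
  set S := (gaussianSpan c a ha).map (SchwartzMap.derivCLM ℝ ℝ).toLinearMap ⊔
    Submodule.span ℝ {monomialMul 0 (gaussianKernel ℝ c a ha)} with hS
  have hmem : ∀ n, monomialMul n (gaussianKernel ℝ c a ha) ∈ gaussianSpan c a ha := fun n =>
    Submodule.subset_span (Set.mem_range_self n)
  have hD : ∀ n, SchwartzMap.derivCLM ℝ ℝ (monomialMul n (gaussianKernel ℝ c a ha)) ∈ S :=
    fun n => (le_sup_left : _ ≤ S) (Submodule.mem_map_of_mem (hmem n))
  have h0 : monomialMul 0 (gaussianKernel ℝ c a ha) ∈ S :=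
    (le_sup_right : _ ≤ S) (Submodule.mem_span_singleton_self _)
  -- The derivative formula is solved for `xⁿ⁺¹φ`. At `n = 0` the truncated `n - 1` is harmless, its
  -- coefficient being zero.
  have hstep : ∀ n, monomialMul (n - 1) (gaussianKernel ℝ c a ha) ∈ S →
      monomialMul (n + 1) (gaussianKernel ℝ c a ha) ∈ S := fun n hn => by
    have h1 := S.smul_mem (2 * a)⁻¹ (S.sub_mem (S.smul_mem (n : ℝ) hn) (hD n))
    rwa [derivCLM_monomialMul_gaussianKernel, sub_sub_cancel,
      inv_smul_smul₀ (by positivity)] at h1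
  have hall : ∀ n, monomialMul n (gaussianKernel ℝ c a ha) ∈ S := fun n => by
    induction n using Nat.strong_induction_on with
    | _ n ih =>
      rcases n with _ | n
      · exact h0
      · exact hstep n (ih (n - 1) (by omega))
  have hpS : p ∈ S := (Submodule.span_le.mpr (Set.range_subset_iff.mpr hall) :
    gaussianSpan c a ha ≤ S) hp
  obtain ⟨_, ⟨q, hq, rfl⟩, z, hz, rfl⟩ := Submodule.mem_sup.mp hpS
  obtain ⟨b, rfl⟩ := Submodule.mem_span_singleton.mp hz
  exact ⟨q, hq, b, rfl⟩

theorem integral_derivCLM (g : 𝓢(ℝ, ℝ)) : ∫ x, SchwartzMap.derivCLM ℝ ℝ g x = 0 := by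
  have hc := g.tendsto_cocompact
  simp_rw [SchwartzMap.derivCLM_apply]
  rw [integral_of_hasDerivAt_of_tendsto (fun x => g.hasDerivAt x)
    (SchwartzMap.derivCLM ℝ ℝ g).integrable (hc.mono_left atBot_le_cocompact)
    (hc.mono_left atTop_le_cocompact), sub_zero]

theorem integral_monomialMul_zero_gaussianKernel_pos {c a : ℝ} (hc : 0 < c) (ha : 0 < a) :
    0 < ∫ x, monomialMul 0 (gaussianKernel ℝ c a ha) x := by
  simp_rw [monomialMul_gaussianKernel_apply, pow_zero, one_mul]
  rw [integral_const_mul, integral_gaussian]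
  positivity

theorem exists_gaussianSpan_weightedL2_deriv_sub_lt {c a : ℝ} (hc : 0 < c) (ha : 0 < a) (n : ℕ) :
    ∀ (K : ℕ) (f : 𝓢(ℝ, ℝ)) {ε : ℝ}, 0 < ε →
      ∃ q ∈ gaussianSpan c a ha,
        ‖weightedL2 K ((SchwartzMap.derivCLM ℝ ℝ ^ n) (f - q))‖ < ε := by
  induction n with
  | zero => exact fun K f ε hε => exists_gaussianSpan_weightedL2_sub_lt K hc ha f hε
  | succ n ih =>
    intro K f ε hε
    set φ := monomialMul 0 (gaussianKernel ℝ c a ha)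
    set D := SchwartzMap.derivCLM ℝ ℝ
    have hI : 0 < ∫ x, φ x := integral_monomialMul_zero_gaussianKernel_pos hc ha
    set I := ∫ x, φ x
    obtain ⟨C, hC, hCle⟩ := exists_abs_integral_le_weightedL2 n
    set A := ‖weightedL2 K ((D ^ n) φ)‖
    have hA : 0 ≤ A := norm_nonneg _
    -- An error `δ` for `D f` becomes at most `δ * B` for `f`: `δ` itself, plus `|b| * A` with `|b|
    -- ≤ C / I * δ`.
    set B := 1 + C / I * A
    have hB : 0 < B := by positivity
    -- Weight `K` is for the target norm, `1 + 2 * n` for the bound on the integral.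
    obtain ⟨p, hp, hlt⟩ := ih (max K (1 + 2 * n)) (D f) (div_pos hε hB)
    obtain ⟨q, hq, b, rfl⟩ := exists_eq_deriv_add_smul ha hp
    refine ⟨q, hq, ?_⟩
    set g := D f - (D q + b • φ) with hg
    set δ := ‖weightedL2 (max K (1 + 2 * n)) ((D ^ n) g)‖
    have hint : ∫ x, g x = -(b * I) := by
      have h1 : ∀ x, g x = D (f - q) x - b * φ x := fun x => by
        rw [map_sub]
        simp only [hg, sub_apply, add_apply, smul_apply, smul_eq_mul]
        ring
      simp_rw [h1]
      rw [integral_sub (D (f - q)).integrable (φ.integrable.const_mul b), integral_const_mul,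
        integral_derivCLM, zero_sub]
    have hb : |b| ≤ C / I * δ := by
      have h1 := (hCle g).trans (mul_le_mul_of_nonneg_left
        (norm_weightedL2_mono (le_max_right K (1 + 2 * n)) ((D ^ n) g)) hC)
      rw [hint, abs_neg, abs_mul, abs_of_pos hI] at h1
      rw [div_mul_eq_mul_div, le_div_iff₀ hI]
      exact h1
    have heq : (D ^ (n + 1)) (f - q) = (D ^ n) g + b • (D ^ n) φ := by
      rw [pow_succ, mul_apply_eq_comp, ← map_smul, ← map_add]
      congr 1
      rw [hg, map_sub]
      abel
    calc ‖weightedL2 K ((D ^ (n + 1)) (f - q))‖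
        ≤ ‖weightedL2 K ((D ^ n) g)‖ + |b| * A := by
          rw [heq, map_add, map_smul]
          refine (norm_add_le _ _).trans (le_of_eq ?_)
          rw [norm_smul, Real.norm_eq_abs]
      _ ≤ δ + C / I * δ * A := by
          gcongr
          exact norm_weightedL2_mono (le_max_left _ _) _
      _ = δ * B := by ring
      _ < ε := (lt_div_iff₀ hB).mp hlt

/-! ### Density in the Schwartz space -/

theorem dense_gaussianSpan {c a : ℝ} (hc : 0 < c) (ha : 0 < a) :
    Dense (gaussianSpan c a ha : Set 𝓢(ℝ, ℝ)) := by
  intro f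
  rw [mem_closure_iff_nhds]
  intro t ht
  obtain ⟨s, r, hr, hst⟩ := ((schwartz_withSeminorms ℝ ℝ ℝ).mem_nhds_iff f t).mp ht
  obtain ⟨N, hN⟩ : ∃ N : ℕ, ∀ i ∈ s, i.1 ≤ N ∧ i.2 < N :=
    ⟨s.sup (fun i => i.1 + i.2 + 1), fun i hi => by
      have := Finset.le_sup (f := fun i : ℕ × ℕ => i.1 + i.2 + 1) hi
      omega⟩
  have hbound : ∀ i : s, ∃ C : ℝ, 0 ≤ C ∧ ∀ g : 𝓢(ℝ, ℝ), SchwartzMap.seminorm ℝ i.1.1 i.1.2 g ≤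
      C * ‖weightedL2 (3 * N) ((SchwartzMap.derivCLM ℝ ℝ ^ N) g)‖ := fun i =>
    exists_seminorm_le_weightedL2 (hN i i.2).1 (hN i i.2).2
  choose C hC0 hC using hbound
  have hS : 0 ≤ ∑ i, C i := Finset.sum_nonneg fun i _ => hC0 i
  obtain ⟨q, hq, hlt⟩ := exists_gaussianSpan_weightedL2_deriv_sub_lt hc ha N (3 * N) f
    (show 0 < r / (1 + ∑ i, C i) by positivity)
  refine ⟨q, hst ?_, hq⟩
  rw [Seminorm.mem_ball, map_sub_rev]
  refine Seminorm.finset_sup_apply_lt hr fun i hi => ?_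
  refine (hC ⟨i, hi⟩ (f - q)).trans_lt ?_
  have hCi : C ⟨i, hi⟩ ≤ ∑ i, C i :=
    Finset.single_le_sum (fun i _ => hC0 i) (Finset.mem_univ _)
  rw [lt_div_iff₀ (by positivity)] at hlt
  refine lt_of_le_of_lt ?_ hlt
  rw [mul_comm]
  gcongr
  linarith

theorem isTotal_monomialMul_gaussianKernel (𝕜 : Type*) [RCLike 𝕜] {c a : ℝ} (hc : 0 < c)
    (ha : 0 < a) : IsTotal 𝕜 fun n : ℕ => monomialMul n (gaussianKernel 𝕜 c a ha) := by
  set V := Submodule.span 𝕜 (Set.range fun n : ℕ => monomialMul n (gaussianKernel 𝕜 c a ha))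
  set J : 𝓢(ℝ, ℝ) →L[ℝ] 𝓢(ℝ, 𝕜) := SchwartzMap.postcompCLM (RCLike.ofRealCLM : ℝ →L[ℝ] 𝕜)
  have hJ : ∀ g, J g ∈ V.topologicalClosure := fun g => by
    refine map_mem_closure J.continuous (dense_gaussianSpan hc ha g) fun p hp => ?_
    have hle : gaussianSpan c a ha ≤ (V.restrictScalars ℝ).comap J.toLinearMap := by
      refine Submodule.span_le.mpr (Set.range_subset_iff.mpr fun n => ?_)
      refine Submodule.subset_span ⟨n, ?_⟩
      ext x
      change _ = ((monomialMul n (gaussianKernel ℝ c a ha) x : ℝ) : 𝕜)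
      rw [monomialMul_gaussianKernel_apply]
      simp [monomialMul_apply, gaussianKernel_apply]
    exact hle hp
  intro f
  -- Splitting into real and imaginary parts reduces to the real case.
  have hf : f = J (SchwartzMap.postcompCLM (RCLike.reCLM : 𝕜 →L[ℝ] ℝ) f) +
      (RCLike.I : 𝕜) • J (SchwartzMap.postcompCLM (RCLike.imCLM : 𝕜 →L[ℝ] ℝ) f) := by
    ext x
    change f x = (RCLike.re (f x) : 𝕜) + RCLike.I * (RCLike.im (f x) : 𝕜)
    rw [mul_comm, RCLike.re_add_im]
  rw [hf]
  exact V.topologicalClosure.add_mem (hJ _) (V.topologicalClosure.smul_mem _ (hJ _))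

end WeakMoments

theorem mainTheorem2 {𝕜 : Type*} [RCLike 𝕜] (c a : ℝ) (hc : 0 < c) (ha : 0 < a) :
    WeakMoments.IsTotal 𝕜
        (fun n : ℕ => WeakMoments.monomialMul n (WeakMoments.gaussianKernel 𝕜 c a ha)) ∧
      ∀ T₁ T₂ : 𝓢(ℝ, 𝕜) →Lₚₜ[𝕜] 𝕜,
        (∀ n : ℕ, WeakMoments.weakMoment T₁ (WeakMoments.gaussianKernel 𝕜 c a ha) n =
          WeakMoments.weakMoment T₂ (WeakMoments.gaussianKernel 𝕜 c a ha) n) →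
        T₁ = T₂ := by
  have htotal := WeakMoments.isTotal_monomialMul_gaussianKernel 𝕜 hc ha
  refine ⟨htotal, fun T₁ T₂ h => ?_⟩
  exact ContinuousLinearMap.ext_on htotal (Set.forall_mem_range.mpr h)
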